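/- For complex parameters $\alpha_0,\alpha_1,\alpha_2,\alpha_3$ with $\alpha_0+\alpha_1+2\alpha_2+\alpha_3=1/2$, let $A_5^{(2)}(\alpha_j)_{0\le j\le 3}$ denote the system of differential equations (with $'=d/dt$) \[ \begin{cases} tq_1' =2q_1^2p_1-q_1^2+(\alpha_0+\alpha_1+\alpha_3)q_1-t+4tp_2+2q_1q_2p_2,\\ tp_1' =-2q_1p_1^2+2q_1p_1-(\alpha_0+\alpha_1+\alpha_3)p_1+\alpha_0-2p_1q_2p_2,\\ tq_2' =2q_2^2p_2-q_2^2+(\alpha_0+\alpha_1+\alpha_3)q_2-t+4tp_1+2q_1p_1q_2,\\ tp_2' =-2q_2p_2^2+2q_2p_2-(\alpha_0+\alpha_1+\alpha_3)p_2+\alpha_1-2q_1p_1p_2. \end{cases} \] (1) Let $c\in\mathbb{C}$, $c\neq 0$, and let $(q_1,p_1,q_2,p_2)$ be a solution of $A_5^{(2)}(\alpha_j)_{0\le j\le 3}$ that is meromorphic at $t=c$, that is, four functions meromorphic at $c$ that satisfy the system on a punctured neighbourhood of $c$. Then each of $q_1$ and $q_2$ has a pole of order at most one at $t=c$ (or none),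 and the residues of $q_1$ and $q_2$ at $t=c$ are of the form $nc$ with $n\in\mathbb{Z}$. (2) Let $(q_1,p_1,q_2,p_2)$ be a rational solution of $A_5^{(2)}(\alpha_j)_{0\le j\le 3}$. Let $a_{\infty,0}$ and $c_{\infty,0}$ be the constant terms of the Laurent series in $t$ of $q_1$ and $q_2$ at $t=\infty$, and let $a_{0,0}$ and $c_{0,0}$ be the constant terms of the Laurent series of $q_1$ and $q_2$ at $t=0$. Then \[ a_{\infty,0}-a_{0,0}\in\mathbb{Z},\qquad c_{\infty,0}-c_{0,0}\in\mathbb{Z}. \] -/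

import Mathlib

open Filter Topology

/-- `a` is the (finite-tailed) Laurent series of `f` at `c`: only finitely many coefficients of
negative index are nonzero, and `f z = ∑ k, a k * (z - c) ^ k` on a punctured neighbourhood. -/
structure IsLaurentSeriesAt (f : ℂ → ℂ) (c : ℂ) (a : ℤ → ℂ) : Prop where
  bddBelow : ∃ N : ℤ, ∀ k < N, a k = 0
  hasSum : ∀ᶠ z in 𝓝[≠] c, HasSum (fun k : ℤ => a k * (z - c) ^ k) (f z)

/-- A function that is meromorphic at `c` has a Laurent series at `c`. -/
theorem MeromorphicAt.exists_isLaurentSeriesAt {f : ℂ → ℂ} {c : ℂ} (hf : MeromorphicAt f c) :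
    ∃ a, IsLaurentSeriesAt f c a := by
  obtain ⟨n, g, hg, hfg⟩ := MeromorphicAt.iff_eventuallyEq_zpow_smul_analyticAt.mp hf
  obtain ⟨p, hp⟩ := hg
  refine ⟨fun k => if n ≤ k then p.coeff (k - n).toNat else 0, ⟨n, fun k hk => ?_⟩, ?_⟩
  · simp [not_le.mpr hk]
  · have h1 : ∀ᶠ z in 𝓝[≠] c, HasSum (fun m : ℕ => (z - c) ^ m • p.coeff m) (g z) :=
      (hasFPowerSeriesAt_iff'.mp hp).filter_mono nhdsWithin_le_nhds
    filter_upwards [h1, hfg, self_mem_nhdsWithin] with z hz hfz hne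
    have hzc : z - c ≠ 0 := sub_ne_zero.mpr hne
    rw [hfz]
    have hinj : Function.Injective (fun m : ℕ => n + (m : ℤ)) := fun x y h => by
      simpa using h
    refine (hinj.hasSum_iff ?_).mp ?_
    · intro k hk
      have : ¬ n ≤ k := fun h => hk ⟨(k - n).toNat, by simp; omega⟩
      simp [this]
    · have h2 := hz.mul_left ((z - c) ^ n)
      simp only [smul_eq_mul] at h2 ⊢
      have h3 : (fun m : ℕ => (z - c) ^ n * ((z - c) ^ m * p.coeff m)) =
          (fun k : ℤ => (if n ≤ k then p.coeff (k - n).toNat else 0) * (z - c) ^ k) ∘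
            (fun m : ℕ => n + (m : ℤ)) := by
        funext m
        simp [zpow_add₀ hzc]
        ring
      rwa [h3] at h2

/-- The Laurent series of a function at a point is unique. -/
theorem IsLaurentSeriesAt.unique {f : ℂ → ℂ} {c : ℂ} {a b : ℤ → ℂ}
    (ha : IsLaurentSeriesAt f c a) (hb : IsLaurentSeriesAt f c b) : a = b := by
  obtain ⟨M, hM⟩ := ha.bddBelow
  obtain ⟨M', hM'⟩ := hb.bddBelow
  set N := min M M' with hN
  set d : ℤ → ℂ := fun k => a k - b k with hd
  have hdN : ∀ k < N, d k = 0 := fun k hk => by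
    simp [hd, hM k (lt_of_lt_of_le hk (min_le_left _ _)),
      hM' k (lt_of_lt_of_le hk (min_le_right _ _))]
  have hsum : ∀ᶠ z in 𝓝[≠] c, HasSum (fun m : ℕ => (z - c) ^ m * d (N + m)) 0 := by
    filter_upwards [ha.hasSum, hb.hasSum, self_mem_nhdsWithin] with z h1 h2 hne
    have hzc : z - c ≠ 0 := sub_ne_zero.mpr hne
    have h3 : HasSum (fun k : ℤ => (z - c) ^ (-N) * (d k * (z - c) ^ k)) 0 := by
      have h := (h1.sub h2).mul_left ((z - c) ^ (-N))
      simpa [hd, sub_mul] using h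
    have hinj : Function.Injective (fun m : ℕ => N + (m : ℤ)) := fun x y h => by
      simpa using h
    have h4 := (hinj.hasSum_iff ?_).mpr h3
    · convert h4 using 2 with m
      simp only [Function.comp_apply]
      rw [mul_left_comm, ← zpow_add₀ hzc, neg_add_cancel_left, zpow_natCast, mul_comm]
    · intro k hk
      have : k < N := by
        by_contra h
        exact hk ⟨(k - N).toNat, by simp; omega⟩
      simp [hdN k this]
  let g : ℂ → ℂ := fun z => if z = c then d N else 0
  let p := FormalMultilinearSeries.ofScalars ℂ (fun m : ℕ => d (N + m))
  have hp : HasFPowerSeriesAt g p c := by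
    rw [hasFPowerSeriesAt_iff']
    rw [eventually_nhdsWithin_iff] at hsum
    filter_upwards [hsum] with z hz
    by_cases h : z = c
    · subst h
      have h5 := hasSum_single (f := fun m : ℕ => (z - z) ^ m • p.coeff m) 0
        (fun m hm => by simp [hm])
      simpa [g, p, FormalMultilinearSeries.coeff_ofScalars] using h5
    · simpa [g, p, h, FormalMultilinearSeries.coeff_ofScalars] using hz h
  have hg0 : ∀ᶠ z in 𝓝[≠] c, g z = 0 := by
    filter_upwards [self_mem_nhdsWithin] with z hz
    simp [g, show z ≠ c from hz]
  have hg : ∀ᶠ z in 𝓝 c, g z = 0 :=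
    (AnalyticAt.frequently_eq_iff_eventually_eq ⟨p, hp⟩ analyticAt_const).mp hg0.frequently
  have hp0 : p = 0 := hp.eq_zero_of_eventually hg
  funext k
  by_cases hk : k < N
  · exact sub_eq_zero.mp (hdN k hk)
  · have h6 : p.coeff (k - N).toNat = 0 := by rw [hp0]; simp [FormalMultilinearSeries.coeff]
    have h7 : N + ((k - N).toNat : ℤ) = k := by omega
    simp only [p, FormalMultilinearSeries.coeff_ofScalars, h7] at h6
    exact sub_eq_zero.mp h6

/-- The coefficients `k ↦ laurentCoeff f c k` of the Laurent series of `f` at `c`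
(meaningful when `f` is meromorphic at `c`). -/
noncomputable def laurentCoeff (f : ℂ → ℂ) (c : ℂ) : ℤ → ℂ :=
  Classical.epsilon (IsLaurentSeriesAt f c)

/-- The coefficients are those of the Laurent series. -/
theorem MeromorphicAt.isLaurentSeriesAt_laurentCoeff {f : ℂ → ℂ} {c : ℂ}
    (hf : MeromorphicAt f c) : IsLaurentSeriesAt f c (laurentCoeff f c) :=
  Classical.epsilon_spec hf.exists_isLaurentSeriesAt

theorem IsLaurentSeriesAt.laurentCoeff_eq {f : ℂ → ℂ} {c : ℂ} {a : ℤ → ℂ}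
    (ha : IsLaurentSeriesAt f c a) : laurentCoeff f c = a :=
  (Classical.epsilon_spec (⟨a, ha⟩ : ∃ a, IsLaurentSeriesAt f c a) :
    IsLaurentSeriesAt f c (laurentCoeff f c)).unique ha

/-- The residue of `f` at `c`: the coefficient of `(z - c) ^ (-1)` in the Laurent series. -/
noncomputable def residueAt (f : ℂ → ℂ) (c : ℂ) : ℂ := laurentCoeff f c (-1)

/-- The coefficient of `t ^ k` in the Laurent series of `f` at `t = ∞`, i.e. the coefficient of
`s ^ (-k)` in the Laurent series at `s = 0` of `s ↦ f (1 / s)`. -/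
noncomputable def laurentCoeffInfty (f : ℂ → ℂ) (k : ℤ) : ℂ :=
  laurentCoeff (fun s => f s⁻¹) 0 (-k)

/-- The four differential equations of the system `A₅⁽²⁾(α₀, α₁, α₂, α₃)`, at the point `t`. -/
structure SasanoEquationsAt (α₀ α₁ α₃ : ℂ) (q₁ p₁ q₂ p₂ : ℂ → ℂ) (t : ℂ) : Prop where
  eq_q₁ : t * deriv q₁ t = 2 * q₁ t ^ 2 * p₁ t - q₁ t ^ 2 + (α₀ + α₁ + α₃) * q₁ t - t
    + 4 * t * p₂ t + 2 * q₁ t * q₂ t * p₂ t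
  eq_p₁ : t * deriv p₁ t = -2 * q₁ t * p₁ t ^ 2 + 2 * q₁ t * p₁ t - (α₀ + α₁ + α₃) * p₁ t + α₀
    - 2 * p₁ t * q₂ t * p₂ t
  eq_q₂ : t * deriv q₂ t = 2 * q₂ t ^ 2 * p₂ t - q₂ t ^ 2 + (α₀ + α₁ + α₃) * q₂ t - t
    + 4 * t * p₁ t + 2 * q₁ t * p₁ t * q₂ t
  eq_p₂ : t * deriv p₂ t = -2 * q₂ t * p₂ t ^ 2 + 2 * q₂ t * p₂ t - (α₀ + α₁ + α₃) * p₂ t + α₁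
    - 2 * q₁ t * p₁ t * p₂ t

/-- `(q₁, p₁, q₂, p₂)` is a solution of `A₅⁽²⁾(α₀, α₁, α₂, α₃)` that is meromorphic at `c`:
the four functions are meromorphic at `c` and satisfy the equations on a punctured neighbourhood
of `c` (on which they are automatically holomorphic, if it is small enough). -/
structure IsMeromorphicSolutionAt (α₀ α₁ α₂ α₃ : ℂ) (q₁ p₁ q₂ p₂ : ℂ → ℂ) (c : ℂ) : Prop where
  param : α₀ + α₁ + 2 * α₂ + α₃ = 1 / 2
  mero_q₁ : MeromorphicAt q₁ c
  mero_p₁ : MeromorphicAt p₁ c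
  mero_q₂ : MeromorphicAt q₂ c
  mero_p₂ : MeromorphicAt p₂ c
  eqns : ∀ᶠ t in 𝓝[≠] c, SasanoEquationsAt α₀ α₁ α₃ q₁ p₁ q₂ p₂ t

/-- The function `ℂ → ℂ` given by a rational function (its values at the poles are irrelevant). -/
noncomputable def ratFun (r : RatFunc ℂ) : ℂ → ℂ := fun t => r.eval (RingHom.id ℂ) t

/-- `(q₁, p₁, q₂, p₂)` is a rational solution of `A₅⁽²⁾(α₀, α₁, α₂, α₃)`: rational functions that
satisfy the equations at all but finitely many points `t`. -/
structure IsRationalSolution (α₀ α₁ α₂ α₃ : ℂ) (q₁ p₁ q₂ p₂ : RatFunc ℂ) : Prop where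
  param : α₀ + α₁ + 2 * α₂ + α₃ = 1 / 2
  eqns : ∀ᶠ t in cofinite,
    SasanoEquationsAt α₀ α₁ α₃ (ratFun q₁) (ratFun p₁) (ratFun q₂) (ratFun p₂) t

/-! Put `h = q₁ p₁ + q₂ p₂` and `A = α₀ + α₁ + α₃`. Each of `f = p₁`, `p₂`, `p₁ + p₂ - 1` satisfies
a linear equation `t f' = L f + const`, with `L` equal to `2 q₁ - 2 h - A`, `2 q₂ - 2 h - A`, `-2 h
- A` respectively. If `f` has order `k ≤ 0` at `c`, then `L` has at most a simple pole there, with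
residue `c k` (`HasLaurentHead.linear_coeff`). The three functions cannot all vanish at `c`, so one
of `q₁ - h`, `q₂ - h`, `h` has at most a simple pole, with residue in `(c / 2) ℤ`.

The equations for `q₁` and `q₂` give `p₂` in terms of `q₁, h` and `p₁` in terms of `q₂, h`. They
exclude poles of order two or more, first for `h` (`head_momentum`), then for `q₁` and `q₂`
(`head_q₁`). With `a, e, η` the residues of `q₁, q₂, h`, the coefficients `d, b` of `(t - c)⁻²` in
`p₂, p₁` satisfy `4 c d = a (a - c - 2 η)` and `4 c b = e (e - c - 2 η)`. If `b = d = 0`, then `a`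
and `e` lie in `{0, c + 2 η}` and `2 η ∈ ℤ c`. If exactly one is nonzero, further coefficients leave
finitely many residues. Both cannot be nonzero.

For rational solutions, `n c / (t - c)` has constant term `0` at `∞` and `-n` at `0`. Removing all
these terms from `q₁` or `q₂` leaves a Laurent polynomial, whose expansions at `0` and `∞` coincide.
-/

/-- `f z = (z - c) ^ k * g z` near `c`, with `g` analytic at `c` and `g c = v`: the Laurent series
of `f` at `c` starts at index `k` or later, and its coefficient of index `k` is `v`. -/
def HasLaurentHead (c : ℂ) (f : ℂ → ℂ) (k : ℤ) (v : ℂ) : Prop :=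
  ∃ g : ℂ → ℂ, AnalyticAt ℂ g c ∧ g c = v ∧ f =ᶠ[𝓝[≠] c] fun z => (z - c) ^ k * g z

/-! ### Calculus of leading Laurent coefficients -/

namespace HasLaurentHead

variable {c : ℂ} {f g : ℂ → ℂ} {j k l : ℤ} {v w : ℂ}

theorem congr (hf : HasLaurentHead c f k v) (h : g =ᶠ[𝓝[≠] c] f) : HasLaurentHead c g k v := by
  obtain ⟨F, hF, hv, he⟩ := hf
  exact ⟨F, hF, hv, h.trans he⟩

theorem of_analyticAt (hf : AnalyticAt ℂ f c) : HasLaurentHead c f 0 (f c) :=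
  ⟨f, hf, rfl, by simp⟩

theorem const (v : ℂ) : HasLaurentHead c (fun _ => v) 0 v := of_analyticAt analyticAt_const

theorem id : HasLaurentHead c (fun z => z) 0 c := of_analyticAt analyticAt_id

theorem add (hf : HasLaurentHead c f k v) (hg : HasLaurentHead c g k w) :
    HasLaurentHead c (fun z => f z + g z) k (v + w) := by
  obtain ⟨F, hF, rfl, hf⟩ := hf
  obtain ⟨G, hG, rfl, hg⟩ := hg
  refine ⟨fun z => F z + G z, hF.add hG, rfl, ?_⟩
  filter_upwards [hf, hg] with z h1 h2
  rw [h1, h2]; ring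

theorem mul (hf : HasLaurentHead c f k v) (hg : HasLaurentHead c g l w) (h : j = k + l) :
    HasLaurentHead c (fun z => f z * g z) j (v * w) := by
  obtain ⟨F, hF, rfl, hf⟩ := hf
  obtain ⟨G, hG, rfl, hg⟩ := hg
  refine ⟨fun z => F z * G z, hF.mul hG, rfl, ?_⟩
  filter_upwards [hf, hg, self_mem_nhdsWithin] with z h1 h2 h3
  rw [h1, h2, h, zpow_add₀ (sub_ne_zero.mpr h3)]; ring

theorem const_mul (hf : HasLaurentHead c f k v) (w : ℂ) :
    HasLaurentHead c (fun z => w * f z) k (w * v) :=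
  (const w).mul hf (by simp)

theorem neg (hf : HasLaurentHead c f k v) : HasLaurentHead c (fun z => -f z) k (-v) := by
  simpa using hf.const_mul (-1)

theorem sub (hf : HasLaurentHead c f k v) (hg : HasLaurentHead c g k w) :
    HasLaurentHead c (fun z => f z - g z) k (v - w) := by
  simpa [sub_eq_add_neg] using hf.add hg.neg

theorem inv (hf : HasLaurentHead c f k v) (hv : v ≠ 0) :
    HasLaurentHead c (fun z => (f z)⁻¹) (-k) v⁻¹ := by
  obtain ⟨F, hF, rfl, hf⟩ := hf
  refine ⟨fun z => (F z)⁻¹, hF.inv hv, rfl, ?_⟩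
  filter_upwards [hf] with z h1
  rw [h1, mul_inv, zpow_neg]

theorem eventually_ne (hf : HasLaurentHead c f k v) (hv : v ≠ 0) : ∀ᶠ z in 𝓝[≠] c, f z ≠ 0 := by
  obtain ⟨F, hF, rfl, hf⟩ := hf
  filter_upwards [hf, (hF.continuousAt.eventually_ne hv).filter_mono nhdsWithin_le_nhds,
    self_mem_nhdsWithin] with z h1 h2 h3
  rw [h1]
  exact mul_ne_zero (zpow_ne_zero _ (sub_ne_zero.mpr h3)) h2

theorem of_lt (hf : HasLaurentHead c f k v) (h : j < k) : HasLaurentHead c f j 0 := by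
  obtain ⟨F, hF, rfl, hf⟩ := hf
  obtain ⟨n, hn⟩ : ∃ n : ℕ, k = j + (n + 1 : ℕ) := ⟨(k - j - 1).toNat, by omega⟩
  refine ⟨fun z => (z - c) ^ (n + 1) * F z, by fun_prop, by simp, ?_⟩
  filter_upwards [hf, self_mem_nhdsWithin] with z h1 h3
  rw [h1, hn, zpow_add₀ (sub_ne_zero.mpr h3), zpow_natCast, mul_assoc]

/-- The analytic factor vanishes at `c`, so one more `z - c` can be divided out. This is how the
next coefficient is reached. -/
theorem succ (hf : HasLaurentHead c f k 0) : ∃ v, HasLaurentHead c f (k + 1) v := by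
  obtain ⟨F, hF, hv, hf⟩ := hf
  obtain ⟨p, hp⟩ := hF
  refine ⟨dslope F c c, dslope F c, ⟨_, hp.has_fpower_series_dslope_fslope⟩, rfl, ?_⟩
  filter_upwards [hf, self_mem_nhdsWithin] with z h1 h3
  have hz : z - c ≠ 0 := sub_ne_zero.mpr h3
  rw [h1, zpow_add₀ hz, dslope_of_ne _ h3, slope_def_field, hv]
  field_simp
  simp

theorem unique (hf : HasLaurentHead c f k v) (hg : HasLaurentHead c f k w) : v = w := by
  obtain ⟨F, hF, rfl, hf⟩ := hf
  obtain ⟨G, hG, rfl, hg⟩ := hg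
  have h : F =ᶠ[𝓝[≠] c] G := by
    filter_upwards [hf, hg, self_mem_nhdsWithin] with z h1 h2 h3
    exact mul_left_cancel₀ (zpow_ne_zero k (sub_ne_zero.mpr h3)) (h1.symm.trans h2)
  have h' : ∀ᶠ z in 𝓝 c, F z = G z :=
    (hF.frequently_eq_iff_eventually_eq hG).mp h.frequently
  exact h'.self_of_nhds

theorem deriv (hf : HasLaurentHead c f k v) : HasLaurentHead c (deriv f) (k - 1) (k * v) := by
  obtain ⟨F, hF, rfl, hf⟩ := hf
  refine ⟨fun z => k * F z + (z - c) * _root_.deriv F z, by fun_prop, by simp, ?_⟩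
  filter_upwards [hf.nhdsNE_deriv, hF.eventually_analyticAt.filter_mono nhdsWithin_le_nhds,
    self_mem_nhdsWithin] with z h1 h2 h3
  have hz : z - c ≠ 0 := sub_ne_zero.mpr h3
  have h4 : HasDerivAt (fun z => (z - c) ^ k) (k * (z - c) ^ (k - 1)) z := by
    simpa [Function.comp_def] using
      (hasDerivAt_zpow k (z - c) (Or.inl hz)).comp z ((hasDerivAt_id z).sub_const c)
  rw [h1, (h4.fun_mul h2.differentiableAt.hasDerivAt).deriv, zpow_sub_one₀ hz]
  field_simp

theorem euler (hf : HasLaurentHead c f k v) (h : j = k - 1) :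
    HasLaurentHead c (fun z => z * _root_.deriv f z) j (c * (k * v)) :=
  id.mul hf.deriv (by omega)

theorem le_meromorphicOrderAt (hf : HasLaurentHead c f k v) :
    (k : WithTop ℤ) ≤ meromorphicOrderAt f c := by
  obtain ⟨F, hF, -, hf⟩ := hf
  have h1 : MeromorphicAt (fun z : ℂ => (z - c) ^ k) c := by fun_prop
  have h2 : meromorphicOrderAt (fun z : ℂ => (z - c) ^ k) c = k := by
    rw [meromorphicOrderAt_eq_int_iff h1]
    exact ⟨fun _ => 1, analyticAt_const, one_ne_zero, by simp⟩
  rw [meromorphicOrderAt_congr hf]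
  change _ ≤ meromorphicOrderAt ((fun z : ℂ => (z - c) ^ k) * F) c
  rw [meromorphicOrderAt_mul h1 hF.meromorphicAt, h2]
  exact le_add_of_nonneg_right hF.meromorphicOrderAt_nonneg

theorem laurentCoeff_eq (hf : HasLaurentHead c f k v) : laurentCoeff f c k = v := by
  obtain ⟨F, ⟨p, hp⟩, rfl, hf⟩ := hf
  have h : IsLaurentSeriesAt f c fun i => if k ≤ i then p.coeff (i - k).toNat else 0 := by
    refine ⟨⟨k, fun i hi => by simp [not_le.mpr hi]⟩, ?_⟩
    filter_upwards [(hasFPowerSeriesAt_iff'.mp hp).filter_mono nhdsWithin_le_nhds, hf,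
      self_mem_nhdsWithin] with z h1 h2 h3
    have hz : z - c ≠ 0 := sub_ne_zero.mpr h3
    have hinj : Function.Injective (fun m : ℕ => k + (m : ℤ)) := fun x y h => by simpa using h
    rw [h2, ← hinj.hasSum_iff]
    · have h4 := h1.mul_left ((z - c) ^ k)
      have h5 : (fun m : ℕ => (z - c) ^ k * ((z - c) ^ m • p.coeff m)) =
          (fun i : ℤ => (if k ≤ i then p.coeff (i - k).toNat else 0) * (z - c) ^ i) ∘
            (fun m : ℕ => k + (m : ℤ)) := by
        funext m
        simp [zpow_add₀ hz]
        ring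
      rwa [h5] at h4
    · intro i hi
      have : ¬ k ≤ i := fun h => hi ⟨(i - k).toNat, by simp; omega⟩
      simp [this]
  rw [h.laurentCoeff_eq]
  simpa using hp.coeff_zero 1

end HasLaurentHead

/-- The working dichotomy: order at least `k` (coefficient possibly zero, `f = 0` included), or
exact order below `k`. With `k = 1` it separates vanishing at `c` from not vanishing. -/
theorem MeromorphicAt.exists_hasLaurentHead {c : ℂ} {f : ℂ → ℂ} (hf : MeromorphicAt f c) (k : ℤ) :
    (∃ v, HasLaurentHead c f k v) ∨ ∃ j < k, ∃ v, v ≠ 0 ∧ HasLaurentHead c f j v := by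
  rcases eq_or_ne (meromorphicOrderAt f c) ⊤ with h | h
  · rw [meromorphicOrderAt_eq_top_iff] at h
    refine Or.inl ⟨0, fun _ => 0, analyticAt_const, rfl, ?_⟩
    filter_upwards [h] with z hz
    simp [hz]
  · obtain ⟨j, hj⟩ := WithTop.ne_top_iff_exists.mp h
    obtain ⟨g, hg, hg0, he⟩ := (meromorphicOrderAt_eq_int_iff hf).mp hj.symm
    have hh : HasLaurentHead c f j (g c) := ⟨g, hg, rfl, he⟩
    rcases lt_trichotomy j k with h1 | rfl | h1
    · exact Or.inr ⟨j, h1, _, hg0, hh⟩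
    · exact Or.inl ⟨_, hh⟩
    · exact Or.inl ⟨_, hh.of_lt h1⟩

/-- The coefficient `L` of a linear equation `t f' = L f + b` has at most a simple pole where `f`
does not vanish. -/
theorem HasLaurentHead.linear_coeff {c : ℂ} {f L : ℂ → ℂ} {k : ℤ} {v b : ℂ}
    (hf : HasLaurentHead c f k v) (hk : k ≤ 0) (hv : v ≠ 0)
    (he : ∀ᶠ t in 𝓝[≠] c, t * _root_.deriv f t = L t * f t + b) :
    HasLaurentHead c L (-1) (c * k) := by
  -- `k ≤ 0` makes the constant negligible beside `t f'`, whose head has index `k - 1`; then `L = (t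
  -- f' - b) / f`.
  have hb : HasLaurentHead c (fun _ => b) (k - 1) 0 := (const b).of_lt (by omega)
  have h := (((hf.euler rfl).sub hb).mul (hf.inv hv) (j := -1) (by ring)).congr (g := L) (by
    filter_upwards [he, hf.eventually_ne hv] with t h1 h2
    rw [h1]
    field_simp
    ring)
  convert h using 1
  field_simp
  ring

/-! ### Local analysis at a point `c ≠ 0` -/

namespace IsMeromorphicSolutionAt

variable {α₀ α₁ α₂ α₃ : ℂ} {q₁ p₁ q₂ p₂ : ℂ → ℂ} {c : ℂ}

/-- The exchange of the indices 1 and 2, with `α₀` and `α₁` swapped, preserves the system; it halves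
every later argument. -/
theorem symm (hs : IsMeromorphicSolutionAt α₀ α₁ α₂ α₃ q₁ p₁ q₂ p₂ c) :
    IsMeromorphicSolutionAt α₁ α₀ α₂ α₃ q₂ p₂ q₁ p₁ c := by
  refine ⟨by linear_combination hs.param, hs.mero_q₂, hs.mero_p₂, hs.mero_q₁, hs.mero_p₁, ?_⟩
  filter_upwards [hs.eqns] with t ht
  refine ⟨?_, ?_, ?_, ?_⟩
  · linear_combination ht.eq_q₂
  · linear_combination ht.eq_p₂
  · linear_combination ht.eq_q₁
  · linear_combination ht.eq_p₁

theorem meromorphicAt_momentum (hs : IsMeromorphicSolutionAt α₀ α₁ α₂ α₃ q₁ p₁ q₂ p₂ c) :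
    MeromorphicAt (fun t => q₁ t * p₁ t + q₂ t * p₂ t) c :=
  (hs.mero_q₁.mul hs.mero_p₁).add (hs.mero_q₂.mul hs.mero_p₂)

/-- The first equation, solved for `p₂`. -/
theorem head_p₂ (hs : IsMeromorphicSolutionAt α₀ α₁ α₂ α₃ q₁ p₁ q₂ p₂ c) (hc : c ≠ 0) {k : ℤ}
    {d s r u w : ℂ} (hd : HasLaurentHead c (fun t => t * deriv q₁ t) k d)
    (hsq : HasLaurentHead c (fun t => q₁ t * q₁ t) k s) (hq : HasLaurentHead c q₁ k r)
    (ht : HasLaurentHead c (fun t => t) k u)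
    (hw : HasLaurentHead c (fun t => q₁ t * (q₁ t * p₁ t + q₂ t * p₂ t)) k w) :
    HasLaurentHead c p₂ k ((d + s - (α₀ + α₁ + α₃) * r + u - 2 * w) / (4 * c)) := by
  have h4 : HasLaurentHead c (fun t => (4 * t)⁻¹) 0 (4 * c)⁻¹ := by
    simpa using (HasLaurentHead.id.const_mul 4).inv (mul_ne_zero (by norm_num : (4 : ℂ) ≠ 0) hc)
  refine (((((hd.add hsq).sub (hq.const_mul (α₀ + α₁ + α₃))).add ht).sub (hw.const_mul 2)).mul h4
    (by simp)).congr ?_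
  filter_upwards [hs.eqns, HasLaurentHead.id.eventually_ne hc] with t h1 h2
  rw [h1.eq_q₁]
  field_simp
  ring

/-- When `k ≤ -2`, only the quadratic terms `q₁ ^ 2` and `q₁ h` reach order `2 k`; the derivative,
linear and inhomogeneous terms start later. -/
theorem head_p₂' (hs : IsMeromorphicSolutionAt α₀ α₁ α₂ α₃ q₁ p₁ q₂ p₂ c) (hc : c ≠ 0) {k : ℤ}
    {v η : ℂ} (hk : k ≤ -2) (hq : HasLaurentHead c q₁ k v)
    (hh : HasLaurentHead c (fun t => q₁ t * p₁ t + q₂ t * p₂ t) k η) :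
    HasLaurentHead c p₂ (2 * k) ((v ^ 2 - 2 * v * η) / (4 * c)) := by
  convert hs.head_p₂ hc (k := 2 * k) ((hq.euler rfl).of_lt (by omega)) (hq.mul hq (by ring))
    (hq.of_lt (by omega)) (HasLaurentHead.id.of_lt (by omega)) (hq.mul hh (by ring)) using 1
  ring

theorem coeff_p₁ (hs : IsMeromorphicSolutionAt α₀ α₁ α₂ α₃ q₁ p₁ q₂ p₂ c) {k : ℤ} {v : ℂ}
    (hp : HasLaurentHead c p₁ k v) (hk : k ≤ 0) (hv : v ≠ 0) :
    HasLaurentHead c (fun t => q₁ t - (q₁ t * p₁ t + q₂ t * p₂ t)) (-1) (c * k / 2) := by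
  have h := hp.linear_coeff hk hv (b := α₀)
    (L := fun t => 2 * q₁ t - 2 * (q₁ t * p₁ t + q₂ t * p₂ t) - (α₀ + α₁ + α₃)) (by
      filter_upwards [hs.eqns] with t h
      rw [h.eq_p₁]; ring)
  convert ((h.add ((HasLaurentHead.const (α₀ + α₁ + α₃)).of_lt (j := -1) (by omega))).const_mul
    (1 / 2)) using 1
  · funext t; ring
  · ring

/-- In the sum of the equations for `p₁` and `p₂`, the terms `2 q₁ p₁ + 2 q₂ p₂ = 2 h` combine with
`-2 h (p₁ + p₂)` into `-2 h (p₁ + p₂ - 1)`. -/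
theorem coeff_p₁_add_p₂ (hs : IsMeromorphicSolutionAt α₀ α₁ α₂ α₃ q₁ p₁ q₂ p₂ c) {k : ℤ} {v : ℂ}
    (hp : HasLaurentHead c (fun t => p₁ t + p₂ t - 1) k v) (hk : k ≤ 0) (hv : v ≠ 0) :
    HasLaurentHead c (fun t => q₁ t * p₁ t + q₂ t * p₂ t) (-1) (-(c * k) / 2) := by
  have hd₁ : ∀ᶠ t in 𝓝[≠] c, AnalyticAt ℂ p₁ t := hs.mero_p₁.eventually_analyticAt
  have hd₂ : ∀ᶠ t in 𝓝[≠] c, AnalyticAt ℂ p₂ t := hs.mero_p₂.eventually_analyticAt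
  have h := hp.linear_coeff hk hv (b := -α₃)
    (L := fun t => -2 * (q₁ t * p₁ t + q₂ t * p₂ t) - (α₀ + α₁ + α₃)) (by
      filter_upwards [hs.eqns, hd₁, hd₂] with t h h1 h2
      rw [((h1.differentiableAt.hasDerivAt.fun_add h2.differentiableAt.hasDerivAt).sub_const
        1).deriv]
      linear_combination h.eq_p₁ + h.eq_p₂)
  convert ((h.add ((HasLaurentHead.const (α₀ + α₁ + α₃)).of_lt (j := -1) (by omega))).const_mul
    (-1 / 2)) using 1
  · funext t; ring
  · ring

/-- The functions `p₁`, `p₂` and `p₁ + p₂ - 1` do not vanish simultaneously. -/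
theorem exists_nonvanishing (hs : IsMeromorphicSolutionAt α₀ α₁ α₂ α₃ q₁ p₁ q₂ p₂ c) :
    (∃ k ≤ 0, ∃ v, v ≠ 0 ∧ HasLaurentHead c p₁ k v) ∨
    (∃ k ≤ 0, ∃ v, v ≠ 0 ∧ HasLaurentHead c p₂ k v) ∨
    (∃ k ≤ 0, ∃ v, v ≠ 0 ∧ HasLaurentHead c (fun t => p₁ t + p₂ t - 1) k v) := by
  have h3 : MeromorphicAt (fun t => p₁ t + p₂ t - 1) c :=
    (hs.mero_p₁.add hs.mero_p₂).sub (MeromorphicAt.const 1 c)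
  rcases hs.mero_p₁.exists_hasLaurentHead 1 with ⟨v, h1⟩ | ⟨k, hk, h⟩
  · rcases hs.mero_p₂.exists_hasLaurentHead 1 with ⟨w, h2⟩ | ⟨k, hk, h⟩
    -- If `p₁` and `p₂` both vanish at `c`, then `p₁ + p₂ - 1` takes the value `-1`.
    · refine Or.inr (Or.inr ⟨0, le_rfl, -1, by simp, ?_⟩)
      simpa using ((h1.of_lt zero_lt_one).add (h2.of_lt zero_lt_one)).sub (HasLaurentHead.const 1)
    · exact Or.inr (Or.inl ⟨k, by omega, h⟩)
  · exact Or.inl ⟨k, by omega, h⟩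

/-- Since `p₁` does not vanish, `q₁ - h` has at most a simple pole, so `q₁` inherits the head `v` of
`h`, and `v ^ 2 - 2 v v = -v ^ 2`. -/
theorem head_p₂_of_momentum (hs : IsMeromorphicSolutionAt α₀ α₁ α₂ α₃ q₁ p₁ q₂ p₂ c) (hc : c ≠ 0)
    {k j : ℤ} {v w : ℂ} (hk : k ≤ -2)
    (hh : HasLaurentHead c (fun t => q₁ t * p₁ t + q₂ t * p₂ t) k v)
    (hj : j ≤ 0) (hw : w ≠ 0) (hp : HasLaurentHead c p₁ j w) :
    HasLaurentHead c p₂ (2 * k) (-v ^ 2 / (4 * c)) := by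
  have hq : HasLaurentHead c q₁ k v := by
    simpa using ((hs.coeff_p₁ hp hj hw).of_lt (j := k) (by omega)).add hh
  convert hs.head_p₂' hc hk hq hh using 1
  ring

/-- A multiple pole of `h` spreads: `p₁` not vanishing gives `p₂` a pole, which by symmetry gives
`p₁` a pole with the same leading term. The two add up without cancelling. -/
theorem exists_head_p₁_add_p₂ (hs : IsMeromorphicSolutionAt α₀ α₁ α₂ α₃ q₁ p₁ q₂ p₂ c) (hc : c ≠ 0)
    {k j : ℤ} {v w : ℂ} (hk : k ≤ -2) (hv : v ≠ 0)
    (hh : HasLaurentHead c (fun t => q₁ t * p₁ t + q₂ t * p₂ t) k v)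
    (hj : j ≤ 0) (hw : w ≠ 0) (hp : HasLaurentHead c p₁ j w) :
    ∃ i ≤ 0, ∃ u, u ≠ 0 ∧ HasLaurentHead c (fun t => p₁ t + p₂ t - 1) i u := by
  have hv' : -v ^ 2 / (4 * c) ≠ 0 := by simp [hv, hc]
  have h2 := hs.head_p₂_of_momentum hc hk hh hj hw hp
  have h1 := hs.symm.head_p₂_of_momentum hc hk (by simpa only [add_comm] using hh) (by omega) hv' h2
  refine ⟨2 * k, by omega, -v ^ 2 / (4 * c) + -v ^ 2 / (4 * c) - 0, ?_,
    (h1.add h2).sub ((HasLaurentHead.const 1).of_lt (by omega))⟩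
  rw [sub_zero, ← two_mul]
  exact mul_ne_zero two_ne_zero hv'

/-- The function `q₁ p₁ + q₂ p₂` has at most a simple pole. -/
theorem head_momentum (hs : IsMeromorphicSolutionAt α₀ α₁ α₂ α₃ q₁ p₁ q₂ p₂ c) (hc : c ≠ 0) :
    ∃ η, HasLaurentHead c (fun t => q₁ t * p₁ t + q₂ t * p₂ t) (-1) η := by
  rcases hs.meromorphicAt_momentum.exists_hasLaurentHead (-1) with h | ⟨k, hk, v, hv, hh⟩
  · exact h
  -- Whichever of the three functions does not vanish, `p₁ + p₂ - 1` does not either, and its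
  -- equation bounds the pole of `h`.
  have key : ∃ i ≤ 0, ∃ u, u ≠ 0 ∧ HasLaurentHead c (fun t => p₁ t + p₂ t - 1) i u := by
    rcases hs.exists_nonvanishing with ⟨j, hj, w, hw, hp⟩ | ⟨j, hj, w, hw, hp⟩ | h
    · exact hs.exists_head_p₁_add_p₂ hc (by omega) hv hh hj hw hp
    · simpa only [add_comm (p₁ _)] using
        hs.symm.exists_head_p₁_add_p₂ hc (k := k) (by omega) hv (by simpa only [add_comm] using hh) hj hw hp
    · exact h
  obtain ⟨i, hi, u, hu, h⟩ := key
  exact ⟨_, hs.coeff_p₁_add_p₂ h hi hu⟩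

/-- The function `q₁` has at most a simple pole. -/
theorem head_q₁ (hs : IsMeromorphicSolutionAt α₀ α₁ α₂ α₃ q₁ p₁ q₂ p₂ c) (hc : c ≠ 0) :
    ∃ a, HasLaurentHead c q₁ (-1) a := by
  obtain ⟨η, hη⟩ := hs.head_momentum hc
  rcases hs.mero_q₁.exists_hasLaurentHead (-1) with h | ⟨k, hk, v, hv, hq⟩
  · exact h
  rcases hs.mero_p₁.exists_hasLaurentHead 1 with ⟨b, hp₁⟩ | ⟨j, hj, w, hw, hp⟩
  swap
  · exact ⟨_, by simpa using (hs.coeff_p₁ hp (by omega) hw).add hη⟩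
  -- Here `p₁` vanishes at `c` while `q₁` has a pole of order `-k ≥ 2`. The orders found below force
  -- `p₁` to equal `1 / 4` at `c`.
  exfalso
  have hp₂ := hs.head_p₂' hc (by omega) hq (hη.of_lt hk)
  rw [mul_zero, sub_zero] at hp₂
  have hv2 : v ^ 2 / (4 * c) ≠ 0 := by simp [hv, hc]
  have hL : HasLaurentHead c
      (fun t => 2 * q₁ t - 2 * (q₁ t * p₁ t + q₂ t * p₂ t) - (α₀ + α₁ + α₃)) k (2 * v) := by
    simpa using ((hq.const_mul 2).sub ((hη.of_lt hk).const_mul 2)).sub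
      ((HasLaurentHead.const (α₀ + α₁ + α₃)).of_lt (by omega))
  have hL0 : 2 * v ≠ 0 := mul_ne_zero two_ne_zero hv
  -- From `p₁ = (t p₁' - α₀) / L`, where `L` has the same pole order as `q₁`: `p₁` vanishes to order
  -- at least `-k`, so `q₁ p₁` is holomorphic.
  have hp₁' := (((hp₁.euler (j := 0) rfl).sub (HasLaurentHead.const α₀)).mul (hL.inv hL0)
    (j := -k) (by ring)).congr (g := p₁) (by
      filter_upwards [hs.eqns, hL.eventually_ne hL0] with t h1 h2
      rw [eq_mul_inv_iff_mul_eq₀ h2, h1.eq_p₁]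
      ring)
  have hqp₁ := hq.mul hp₁' (j := 0) (by ring)
  -- `q₂ = (h - q₁ p₁) / p₂` vanishes to order at least `-1 - 2 k ≥ 3`, so in the second equation
  -- solved for `p₁` only `t / (4 t)` survives at `c`.
  have hq₂ := ((hη.sub (hqp₁.of_lt (by omega))).mul (hp₂.inv hv2) (j := -1 - 2 * k)
    (by ring)).congr (g := q₂) (by
      filter_upwards [hp₂.eventually_ne hv2] with t h2
      rw [eq_mul_inv_iff_mul_eq₀ h2]
      ring)
  have hη' : HasLaurentHead c (fun t => q₂ t * p₂ t + q₁ t * p₁ t) (-1) η := by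
    simpa only [add_comm] using hη
  have h := hs.symm.head_p₂ hc (k := 0) ((hq₂.euler rfl).of_lt (by omega))
    ((hq₂.mul hq₂ rfl).of_lt (by omega)) (hq₂.of_lt (by omega)) HasLaurentHead.id
    ((hq₂.mul hη' rfl).of_lt (by omega))
  have h0 := h.unique (hp₁.of_lt zero_lt_one)
  simp [hc] at h0

/-- The relation between the coefficients of `q₁`, `p₂` and `q₁ p₁ + q₂ p₂`. -/
theorem head_p₂_neg_two (hs : IsMeromorphicSolutionAt α₀ α₁ α₂ α₃ q₁ p₁ q₂ p₂ c) (hc : c ≠ 0)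
    {a η : ℂ} (hq : HasLaurentHead c q₁ (-1) a)
    (hh : HasLaurentHead c (fun t => q₁ t * p₁ t + q₂ t * p₂ t) (-1) η) :
    HasLaurentHead c p₂ (-2) (a * (a - c - 2 * η) / (4 * c)) := by
  convert hs.head_p₂ hc (k := -2) (hq.euler rfl) (hq.mul hq rfl)
    (hq.of_lt (by omega)) (HasLaurentHead.id.of_lt (by omega)) (hq.mul hh rfl) using 1
  push_cast
  ring

/-- The residues when `p₁` has a double pole and `p₂` does not. -/
theorem residues_of_double_pole (hs : IsMeromorphicSolutionAt α₀ α₁ α₂ α₃ q₁ p₁ q₂ p₂ c) (hc : c ≠ 0)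
    {a e η b : ℂ} (hq₁ : HasLaurentHead c q₁ (-1) a) (hq₂ : HasLaurentHead c q₂ (-1) e)
    (hh : HasLaurentHead c (fun t => q₁ t * p₁ t + q₂ t * p₂ t) (-1) η)
    (hp₁ : HasLaurentHead c p₁ (-2) b) (hp₂ : HasLaurentHead c p₂ (-2) 0) (hb : b ≠ 0)
    (hbe : 4 * c * b = e * (e - c - 2 * η)) :
    (∃ n : ℤ, a = n * c) ∧ ∃ n : ℤ, e = n * c := by
  have h3 : HasLaurentHead c (fun t => p₁ t + p₂ t - 1) (-2) b := by
    simpa using (hp₁.add hp₂).sub ((HasLaurentHead.const 1).of_lt (by omega))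
  obtain rfl : η = c := by
    rw [hh.unique (hs.coeff_p₁_add_p₂ h3 (by omega) hb)]; push_cast; ring
  obtain rfl : a = 0 := by
    have := (hq₁.sub hh).unique (hs.coeff_p₁ hp₁ (by omega) hb)
    push_cast at this
    linear_combination this
  refine ⟨⟨0, by simp⟩, ?_⟩
  obtain ⟨r, hr⟩ := hq₁.succ
  obtain ⟨d, hd⟩ := hp₂.succ
  norm_num at hr hd
  have h1 : d = _ := hd.unique (hs.head_p₂ hc (k := -1) (hr.euler rfl)
    ((hr.mul hr rfl).of_lt (by omega)) (hr.of_lt (by omega)) (HasLaurentHead.id.of_lt (by omega))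
    (hr.mul hh rfl))
  have h1' : d = - r / 2 := by rw [h1]; field_simp; simp; ring
  -- The coefficient of index `-2` in `q₁ p₁ + q₂ p₂` is zero because `h` has at most a simple pole:
  -- `r b + e d = 0`.
  have h2 := ((hr.mul hp₁ (j := -2) rfl).add (hq₂.mul hd rfl)).unique (hh.of_lt (by omega))
  rcases eq_or_ne d 0 with rfl | hd0
  · obtain rfl : r = 0 := by linear_combination 2 * h1'
    obtain ⟨s, hs1⟩ := hr.succ
    obtain ⟨u, hu⟩ := hd.succ
    norm_num at hs1 hu
    -- Now `q₁` vanishes at `c` and `p₂` takes the value `u` there. If `u = 0`, then `s = 1` and `b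
    -- = c`, so `e` is `4 c` or `-c`; otherwise the equation for `p₂` gives `e = η = c`.
    rcases eq_or_ne u 0 with rfl | hu0
    · have h4 := hu.unique (hs.head_p₂ hc (k := 0) (hs1.euler rfl)
        ((hs1.mul hs1 rfl).of_lt (by omega)) (hs1.of_lt (by omega)) HasLaurentHead.id
        (hs1.mul hh rfl))
      obtain rfl : s = 1 := by
        field_simp at h4
        refine mul_left_cancel₀ hc ?_
        push_cast at h4
        linear_combination h4
      have h5 := ((hs1.mul hp₁ (j := -1) rfl).add (hq₂.mul hu rfl)).unique hh
      have h7 : (e - 4 * η) * (e + η) = 0 := by linear_combination 4 * η * h5 - hbe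
      rcases mul_eq_zero.mp h7 with h | h
      · exact ⟨4, by push_cast; linear_combination h⟩
      · exact ⟨-1, by push_cast; linear_combination h⟩
    · have h4 := (hq₂.sub hh).unique (by
        simpa only [add_comm] using hs.symm.coeff_p₁ hu le_rfl hu0)
      exact ⟨1, by push_cast at h4 ⊢; linear_combination h4⟩
  -- With `r = -2 d`, cancelling `d` in `r b + e d = 0` gives `e = 2 b`; the quadratic relation
  -- becomes `e (e - 5 c) = 0`.
  · have h4 : e = 2 * b := mul_left_cancel₀ hd0 (by linear_combination h2 - 2 * b * h1')
    have h5 : e * (e - 5 * η) = 0 := by linear_combination -hbe + (-2 * η) * h4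
    rcases mul_eq_zero.mp h5 with h | h
    · exact ⟨0, by simp [h]⟩
    · exact ⟨5, by push_cast; linear_combination h⟩

/-- The functions `q₁` and `q₂` have at most simple poles, with residues in `ℤ c`. -/
theorem residues (hs : IsMeromorphicSolutionAt α₀ α₁ α₂ α₃ q₁ p₁ q₂ p₂ c) (hc : c ≠ 0) :
    (∃ n : ℤ, HasLaurentHead c q₁ (-1) (n * c)) ∧ ∃ n : ℤ, HasLaurentHead c q₂ (-1) (n * c) := by
  obtain ⟨η, hh⟩ := hs.head_momentum hc
  obtain ⟨a, hq₁⟩ := hs.head_q₁ hc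
  obtain ⟨e, hq₂⟩ := hs.symm.head_q₁ hc
  have hh' : HasLaurentHead c (fun t => q₂ t * p₂ t + q₁ t * p₁ t) (-1) η := by
    simpa only [add_comm] using hh
  suffices (∃ n : ℤ, a = n * c) ∧ ∃ n : ℤ, e = n * c by
    obtain ⟨⟨n, rfl⟩, ⟨m, rfl⟩⟩ := this
    exact ⟨⟨n, hq₁⟩, ⟨m, hq₂⟩⟩
  obtain ⟨d, hd⟩ : ∃ d, d = a * (a - c - 2 * η) / (4 * c) := ⟨_, rfl⟩
  obtain ⟨b, hb⟩ : ∃ b, b = e * (e - c - 2 * η) / (4 * c) := ⟨_, rfl⟩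
  have hp₂ := hs.head_p₂_neg_two hc hq₁ hh
  have hp₁ := hs.symm.head_p₂_neg_two hc hq₂ hh'
  rw [← hd] at hp₂
  rw [← hb] at hp₁
  replace hd : 4 * c * d = a * (a - c - 2 * η) := by rw [hd]; field_simp
  replace hb : 4 * c * b = e * (e - c - 2 * η) := by rw [hb]; field_simp
  rcases eq_or_ne b 0 with rfl | hb0 <;> rcases eq_or_ne d 0 with rfl | hd0
  · have ha : a = 0 ∨ a = c + 2 * η := by
      rcases mul_eq_zero.mp (hd.symm.trans (mul_zero _)) with h | h
      · exact Or.inl h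
      · exact Or.inr (by linear_combination h)
    have he : e = 0 ∨ e = c + 2 * η := by
      rcases mul_eq_zero.mp (hb.symm.trans (mul_zero _)) with h | h
      · exact Or.inl h
      · exact Or.inr (by linear_combination h)
    have hη : ∃ n : ℤ, 2 * η = n * c := by
      rcases hs.exists_nonvanishing with ⟨k, hk, v, hv, h⟩ | ⟨k, hk, v, hv, h⟩ | ⟨k, hk, v, hv, h⟩
      · have h1 := (hq₁.sub hh).unique (hs.coeff_p₁ h hk hv)
        rcases ha with rfl | rfl
        · exact ⟨-k, by push_cast; linear_combination -2 * h1⟩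
        · exact ⟨k - 2, by push_cast; linear_combination 2 * h1⟩
      · have h1 := (hq₂.sub hh').unique (hs.symm.coeff_p₁ h hk hv)
        rcases he with rfl | rfl
        · exact ⟨-k, by push_cast; linear_combination -2 * h1⟩
        · exact ⟨k - 2, by push_cast; linear_combination 2 * h1⟩
      · have h1 := hh.unique (hs.coeff_p₁_add_p₂ h hk hv)
        exact ⟨-k, by push_cast; linear_combination 2 * h1⟩
    obtain ⟨n, hn⟩ := hη
    have key : ∀ x : ℂ, x = 0 ∨ x = c + 2 * η → ∃ n : ℤ, x = n * c := by
      rintro x (rfl | rfl)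
      · exact ⟨0, by simp⟩
      · exact ⟨n + 1, by push_cast; linear_combination hn⟩
    exact ⟨key a ha, key e he⟩
  · exact (hs.symm.residues_of_double_pole hc hq₂ hq₁ hh' hp₂ hp₁ hd0 hd).symm
  · exact hs.residues_of_double_pole hc hq₁ hq₂ hh hp₁ hp₂ hb0 hb
  -- Two double poles give `a = e = η - c`, hence `b = d`, so the double poles add up in `p₁ + p₂ -
  -- 1`. Then `η = c`, so `a = 0` and `d = 0`.
  · exfalso
    have h1 := (hq₁.sub hh).unique (hs.coeff_p₁ hp₁ (by omega) hb0)
    have h2 := (hq₂.sub hh').unique (hs.symm.coeff_p₁ hp₂ (by omega) hd0)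
    have h3 := (hp₁.add hp₂).sub ((HasLaurentHead.const 1).of_lt (j := -2) (by omega))
    have hae : a = e := by linear_combination h1 - h2
    have hbd : d = b := mul_left_cancel₀ (mul_ne_zero (by norm_num : (4 : ℂ) ≠ 0) hc) (by
      rw [hb, hd, hae])
    have hη := hh.unique (hs.coeff_p₁_add_p₂ h3 (by omega) (by
      rw [sub_zero, hbd, ← two_mul]; exact mul_ne_zero two_ne_zero hb0))
    push_cast at h1 hη
    have ha : a = 0 := by linear_combination h1 + hη
    rw [ha, zero_mul] at hd
    exact mul_ne_zero (mul_ne_zero (by norm_num : (4 : ℂ) ≠ 0) hc) hd0 hd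

end IsMeromorphicSolutionAt

/-! ### Laurent series of rational functions at `0` and `∞` -/

theorem laurentCoeff_eq_add {F f g : ℂ → ℂ} {c : ℂ} (hf : MeromorphicAt f c)
    (hg : MeromorphicAt g c) (h : ∀ᶠ z in 𝓝[≠] c, F z = f z + g z) (k : ℤ) :
    laurentCoeff F c k = laurentCoeff f c k + laurentCoeff g c k := by
  have h1 := hf.isLaurentSeriesAt_laurentCoeff
  have h2 := hg.isLaurentSeriesAt_laurentCoeff
  have h3 : IsLaurentSeriesAt F c fun k => laurentCoeff f c k + laurentCoeff g c k := by
    obtain ⟨N, hN⟩ := h1.bddBelow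
    obtain ⟨M, hM⟩ := h2.bddBelow
    refine ⟨⟨min N M, fun k hk => ?_⟩, ?_⟩
    · rw [hN k (by omega), hM k (by omega), add_zero]
    · filter_upwards [h, h1.hasSum, h2.hasSum] with z hz hz1 hz2
      rw [hz]
      simpa only [add_mul] using hz1.add hz2
  rw [h3.laurentCoeff_eq]

theorem laurentCoeff_zero_of_hasSum {f : ℂ → ℂ} {b : ℤ → ℂ} {N : ℤ} (hN : ∀ k < N, b k = 0)
    (h : ∀ t ≠ 0, HasSum (fun k : ℤ => b k * t ^ k) (f t)) : laurentCoeff f 0 = b := by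
  refine IsLaurentSeriesAt.laurentCoeff_eq ⟨⟨N, hN⟩, ?_⟩
  filter_upwards [self_mem_nhdsWithin] with t ht
  simpa using h t ht

theorem laurentCoeffInfty_of_hasSum {f : ℂ → ℂ} {b : ℤ → ℂ} {N : ℤ} (hN : ∀ k > N, b k = 0)
    (h : ∀ t ≠ 0, HasSum (fun k : ℤ => b k * t ^ k) (f t)) (k : ℤ) :
    laurentCoeffInfty f k = b k := by
  rw [laurentCoeffInfty, laurentCoeff_zero_of_hasSum (b := fun k => b (-k)) (N := -N)
    (fun k hk => hN _ (by omega))]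
  · simp
  · intro t ht
    rw [← (Equiv.neg ℤ).hasSum_iff]
    simpa [Function.comp_def] using h t⁻¹ (inv_ne_zero ht)

theorem Polynomial.hasSum_coeff_mul_zpow (p : Polynomial ℂ) (m : ℕ) {t : ℂ} (ht : t ≠ 0) :
    HasSum (fun k : ℤ => (if -(m : ℤ) ≤ k then p.coeff (k + m).toNat else 0) * t ^ k)
      (p.eval t / t ^ m) := by
  have hinj : Function.Injective (fun n : ℕ => (n : ℤ) - m) := fun x y h => by simpa using h
  rw [← hinj.hasSum_iff]
  · have h : HasSum (fun n : ℕ => p.coeff n * t ^ n) (p.eval t) := by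
      rw [Polynomial.eval_eq_sum_range]
      refine hasSum_sum_of_ne_finset_zero fun n hn => ?_
      rw [Polynomial.coeff_eq_zero_of_natDegree_lt (by simpa using hn), zero_mul]
    have h2 := h.div_const (t ^ m)
    have h3 : (fun n : ℕ => p.coeff n * t ^ n / t ^ m) =
        (fun k : ℤ => (if -(m : ℤ) ≤ k then p.coeff (k + m).toNat else 0) * t ^ k) ∘
          (fun n : ℕ => (n : ℤ) - m) := by
      funext n
      simp [zpow_sub₀ ht, mul_div_assoc]
    rwa [h3] at h2
  · intro k hk
    have : ¬ -(m : ℤ) ≤ k := fun h => hk ⟨(k + m).toNat, by simp; omega⟩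
    simp [this]

theorem ratFun_apply (r : RatFunc ℂ) (t : ℂ) :
    ratFun r t = r.num.eval t / r.denom.eval t := rfl

theorem eventually_cofinite_eval_ne_zero {q : Polynomial ℂ} (hq : q ≠ 0) :
    ∀ᶠ t in cofinite, q.eval t ≠ 0 := by
  have h : {t : ℂ | q.IsRoot t}.Finite := Polynomial.finite_setOfPred_isRoot hq
  filter_upwards [h.compl_mem_cofinite] with t ht using ht

theorem eventually_nhdsNE_of_cofinite {P : ℂ → Prop} (h : ∀ᶠ t in cofinite, P t) (c : ℂ) :
    ∀ᶠ t in 𝓝[≠] c, P t :=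
  h.filter_mono (nhdsNE_le_cofinite c)

theorem tendsto_inv_nhdsNE_cofinite :
    Tendsto (fun s : ℂ => s⁻¹) (𝓝[≠] 0) cofinite :=
  inv_injective.tendsto_cofinite.mono_left (nhdsNE_le_cofinite 0)

theorem ratFun_div (p : Polynomial ℂ) {q : Polynomial ℂ} {t : ℂ} (hq : q.eval t ≠ 0) :
    ratFun (algebraMap _ _ p / algebraMap _ _ q) t = p.eval t / q.eval t := by
  have hq0 : q ≠ 0 := by rintro rfl; simp at hq
  have h1 := congrArg (Polynomial.eval t) ((RatFunc.num_mul_eq_mul_denom_iff (p := p) hq0).mpr rfl)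
  have h2 : (algebraMap _ (RatFunc ℂ) p / algebraMap _ _ q).denom.eval t ≠ 0 := fun h =>
    hq (Polynomial.eval_eq_zero_of_dvd_of_eval_eq_zero (RatFunc.denom_div_dvd p q) h)
  rw [ratFun_apply, div_eq_div_iff h2 hq]
  simpa using h1

theorem MeromorphicAt.polynomial_eval {f : ℂ → ℂ} {c : ℂ} (hf : MeromorphicAt f c)
    (p : Polynomial ℂ) : MeromorphicAt (fun t => p.eval (f t)) c := by
  simp only [Polynomial.eval_eq_sum_range]
  fun_prop

theorem meromorphicAt_ratFun_comp {f : ℂ → ℂ} {c : ℂ} (hf : MeromorphicAt f c) (r : RatFunc ℂ) :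
    MeromorphicAt (fun t => ratFun r (f t)) c :=
  (hf.polynomial_eval r.num).div (hf.polynomial_eval r.denom)

theorem analyticAt_ratFun {r : RatFunc ℂ} {c : ℂ} (h : r.denom.eval c ≠ 0) :
    AnalyticAt ℂ (ratFun r) c := by
  exact (AnalyticOnNhd.eval_polynomial r.num c trivial).div
    (AnalyticOnNhd.eval_polynomial r.denom c trivial) h

theorem exists_ratFun_sub (r : RatFunc ℂ) (a x : ℂ) :
    ∃ r' : RatFunc ℂ, ∀ᶠ t in cofinite, ratFun r t = ratFun r' t + a / (t - x) := by
  refine ⟨algebraMap _ _ (r.num * (Polynomial.X - Polynomial.C x) - Polynomial.C a * r.denom) /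
    algebraMap _ _ (r.denom * (Polynomial.X - Polynomial.C x)), ?_⟩
  filter_upwards [eventually_cofinite_eval_ne_zero r.denom_ne_zero,
    eventually_cofinite_eval_ne_zero (Polynomial.X_sub_C_ne_zero x)] with t h1 h2
  rw [ratFun_div _ (by simpa using ⟨h1, by simpa using h2⟩), ratFun_apply]
  simp only [Polynomial.eval_sub, Polynomial.eval_X, Polynomial.eval_C, Polynomial.eval_mul] at *
  field_simp
  ring

/-- A zero of the denominator at `c` would, by boundedness of `r` near `c`, be a zero of the
numerator too, against coprimality. -/
theorem denom_eval_ne_zero_of_head {r : RatFunc ℂ} {c v : ℂ}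
    (h : HasLaurentHead c (ratFun r) 0 v) : r.denom.eval c ≠ 0 := by
  intro h0
  have h1 := (h.mul (.of_analyticAt (AnalyticOnNhd.eval_polynomial r.denom c trivial))
    (j := 0) rfl).congr (g := fun t => r.num.eval t) (by
      filter_upwards [eventually_nhdsNE_of_cofinite
        (eventually_cofinite_eval_ne_zero r.denom_ne_zero) c] with t ht
      rw [ratFun_apply, div_mul_cancel₀ _ ht])
  have h2 := (HasLaurentHead.of_analyticAt (AnalyticOnNhd.eval_polynomial r.num c trivial)).unique h1
  rw [h0, mul_zero] at h2
  obtain ⟨u, v, huv⟩ := r.isCoprime_num_denom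
  have := congrArg (Polynomial.eval c) huv
  simp [h0, h2] at this

theorem denom_eq_X_pow {r : RatFunc ℂ} (h : ∀ c ≠ 0, r.denom.eval c ≠ 0) :
    r.denom = Polynomial.X ^ r.denom.roots.card := by
  have hs := (IsAlgClosed.splits r.denom).eq_prod_roots
  have hr : r.denom.roots = Multiset.replicate r.denom.roots.card 0 := by
    refine Multiset.eq_replicate_card.mpr fun c hc => ?_
    by_contra hc0
    exact h c hc0 (Polynomial.isRoot_of_mem_roots hc)
  rw [r.monic_denom.leadingCoeff, hr] at hs
  simpa using hs

/-- The denominator is a power of `X`, so one finite sum is the expansion at both `0` and `∞`. -/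
theorem constant_terms_eq_of_no_poles {r : RatFunc ℂ} (h : ∀ c ≠ 0, r.denom.eval c ≠ 0) :
    laurentCoeffInfty (ratFun r) 0 = laurentCoeff (ratFun r) 0 0 := by
  set m := r.denom.roots.card with hm
  have hsum : ∀ t ≠ 0, HasSum (fun k : ℤ => (if -(m : ℤ) ≤ k then r.num.coeff (k + m).toNat
      else 0) * t ^ k) (ratFun r t) := by
    intro t ht
    convert r.num.hasSum_coeff_mul_zpow m ht using 1
    rw [ratFun_apply, denom_eq_X_pow h]
    simp [hm]
  rw [laurentCoeff_zero_of_hasSum (N := -m) (fun k hk => if_neg (by omega)) hsum,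
    laurentCoeffInfty_of_hasSum (N := r.num.natDegree) (fun k hk => ?_) hsum]
  rw [Polynomial.coeff_eq_zero_of_natDegree_lt (by omega), ite_self]

/-- If the poles `c ≠ 0` of a rational function are simple, with residues in `ℤ c`, then its
constant terms at `∞` and at `0` differ by an integer. -/
theorem constant_terms_sub_mem_int (S : Finset ℂ) (h0 : 0 ∉ S) (r : RatFunc ℂ)
    (hS : ∀ c ∈ S, ∃ n : ℤ, HasLaurentHead c (ratFun r) (-1) (n * c))
    (hS' : ∀ c ≠ 0, c ∉ S → ∃ v, HasLaurentHead c (ratFun r) 0 v) :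
    ∃ n : ℤ, laurentCoeffInfty (ratFun r) 0 - laurentCoeff (ratFun r) 0 0 = n := by
  induction S using Finset.induction_on generalizing r with
  | empty =>
    refine ⟨0, ?_⟩
    rw [constant_terms_eq_of_no_poles fun c hc => ?_]
    · simp
    · obtain ⟨v, hv⟩ := hS' c hc (by simp)
      exact denom_eval_ne_zero_of_head hv
  | insert x S hx ih =>
    rw [Finset.mem_insert, not_or] at h0
    obtain ⟨n, hn⟩ := hS x (Finset.mem_insert_self x S)
    obtain ⟨r', hr'⟩ := exists_ratFun_sub r (n * x) x
    have hx0 : x ≠ 0 := fun h => h0.1 h.symm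
    have hpole : ∀ c ≠ x, AnalyticAt ℂ (fun t => n * x / (t - x)) c := fun c hc =>
      analyticAt_const.div (analyticAt_id.sub analyticAt_const) (sub_ne_zero.mpr hc)
    have hsub (c : ℂ) : ratFun r' =ᶠ[𝓝[≠] c] fun t => ratFun r t - n * x / (t - x) := by
      filter_upwards [eventually_nhdsNE_of_cofinite hr' c] with t ht
      rw [ht, add_sub_cancel_right]
    have ih₁ : ∀ c ∈ S, ∃ n : ℤ, HasLaurentHead c (ratFun r') (-1) (n * c) := by
      intro c hc
      obtain ⟨m, hm⟩ := hS c (Finset.mem_insert_of_mem hc)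
      have hcx : c ≠ x := fun h => hx (h ▸ hc)
      refine ⟨m, ?_⟩
      simpa using (hm.sub ((HasLaurentHead.of_analyticAt (hpole c hcx)).of_lt
        (by omega))).congr (hsub c)
    have ih₂ : ∀ c ≠ 0, c ∉ S → ∃ v, HasLaurentHead c (ratFun r') 0 v := by
      intro c hc hcS
      rcases eq_or_ne c x with rfl | hcx
      · have h1 : HasLaurentHead c (fun t => n * c / (t - c)) (-1) (n * c) :=
          ⟨fun _ => n * c, analyticAt_const, rfl, .of_forall fun z => by
            simp [div_eq_mul_inv, mul_comm]⟩
        -- The leading coefficients cancel at `x`, so the remainder has no pole there.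
        simpa using ((sub_self (n * c) ▸ hn.sub h1).congr (hsub c)).succ
      · obtain ⟨v, hv⟩ := hS' c hc (by simp [hcx, hcS])
        exact ⟨_, (hv.sub (HasLaurentHead.of_analyticAt (hpole c hcx))).congr (hsub c)⟩
    obtain ⟨k, hk⟩ := ih h0.2 r' ih₁ ih₂
    refine ⟨k + n, ?_⟩
    have e0 : laurentCoeff (ratFun r) 0 0 = laurentCoeff (ratFun r') 0 0 + -n := by
      rw [laurentCoeff_eq_add (meromorphicAt_ratFun_comp (MeromorphicAt.id 0) r')
        (hpole 0 hx0.symm).meromorphicAt (eventually_nhdsNE_of_cofinite hr' 0)]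
      rw [(HasLaurentHead.of_analyticAt (hpole 0 hx0.symm)).laurentCoeff_eq]
      simp only [id_eq]
      field_simp
      ring
    -- This is `n x / (t - x)` in the coordinate `s = 1 / t`; it vanishes at `s = 0`, so the
    -- constant term at `∞` does not change.
    have ha : AnalyticAt ℂ (fun s : ℂ => n * x * s / (1 - x * s)) 0 := by
      refine AnalyticAt.div (by fun_prop) (by fun_prop) (by simp)
    have e1 : laurentCoeffInfty (ratFun r) 0 = laurentCoeffInfty (ratFun r') 0 := by
      unfold laurentCoeffInfty
      rw [neg_zero, laurentCoeff_eq_add (F := fun s => ratFun r s⁻¹)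
        (meromorphicAt_ratFun_comp (MeromorphicAt.id 0).inv r') ha.meromorphicAt]
      · rw [(HasLaurentHead.of_analyticAt ha).laurentCoeff_eq]
        simp
      · filter_upwards [tendsto_inv_nhdsNE_cofinite.eventually hr', self_mem_nhdsWithin]
          with s hs hs0
        have hs0 : s ≠ 0 := hs0
        rw [hs]
        congr 1
        rw [show 1 - x * s = s * (s⁻¹ - x) by field_simp, mul_comm _ s,
          mul_div_mul_left _ _ hs0]
    rw [e0, e1]
    push_cast
    linear_combination hk

theorem constant_terms_sub_mem_int_of_residues (r : RatFunc ℂ)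
    (h : ∀ c ≠ 0, ∃ n : ℤ, HasLaurentHead c (ratFun r) (-1) (n * c)) :
    ∃ n : ℤ, laurentCoeffInfty (ratFun r) 0 - laurentCoeff (ratFun r) 0 0 = n := by
  refine constant_terms_sub_mem_int (r.denom.roots.toFinset.erase 0) (by simp) r
    (fun c hc => h c (Finset.ne_of_mem_erase hc)) (fun c hc hcS => ?_)
  refine ⟨_, HasLaurentHead.of_analyticAt (analyticAt_ratFun fun h => hcS ?_)⟩
  simpa [hc, r.denom_ne_zero] using h

theorem IsRationalSolution.isMeromorphicSolutionAt {α₀ α₁ α₂ α₃ : ℂ} {q₁ p₁ q₂ p₂ : RatFunc ℂ}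
    (h : IsRationalSolution α₀ α₁ α₂ α₃ q₁ p₁ q₂ p₂) (c : ℂ) :
    IsMeromorphicSolutionAt α₀ α₁ α₂ α₃ (ratFun q₁) (ratFun p₁) (ratFun q₂) (ratFun p₂) c where
  param := h.param
  mero_q₁ := meromorphicAt_ratFun_comp (MeromorphicAt.id c) q₁
  mero_p₁ := meromorphicAt_ratFun_comp (MeromorphicAt.id c) p₁
  mero_q₂ := meromorphicAt_ratFun_comp (MeromorphicAt.id c) q₂
  mero_p₂ := meromorphicAt_ratFun_comp (MeromorphicAt.id c) p₂
  eqns := eventually_nhdsNE_of_cofinite h.eqns c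

theorem mainTheorem4 :
    (∀ (α₀ α₁ α₂ α₃ : ℂ) (q₁ p₁ q₂ p₂ : ℂ → ℂ) (c : ℂ), c ≠ 0 →
      IsMeromorphicSolutionAt α₀ α₁ α₂ α₃ q₁ p₁ q₂ p₂ c →
        (((-1 : ℤ) : WithTop ℤ) ≤ meromorphicOrderAt q₁ c ∧
          ((-1 : ℤ) : WithTop ℤ) ≤ meromorphicOrderAt q₂ c) ∧
        (∃ n : ℤ, residueAt q₁ c = n * c) ∧ (∃ n : ℤ, residueAt q₂ c = n * c)) ∧
    (∀ (α₀ α₁ α₂ α₃ : ℂ) (q₁ p₁ q₂ p₂ : RatFunc ℂ),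
      IsRationalSolution α₀ α₁ α₂ α₃ q₁ p₁ q₂ p₂ →
        (∃ n : ℤ, laurentCoeffInfty (ratFun q₁) 0 - laurentCoeff (ratFun q₁) 0 0 = n) ∧
        (∃ n : ℤ, laurentCoeffInfty (ratFun q₂) 0 - laurentCoeff (ratFun q₂) 0 0 = n)) := by
  constructor
  · intro α₀ α₁ α₂ α₃ q₁ p₁ q₂ p₂ c hc hs
    obtain ⟨⟨n, hn⟩, ⟨m, hm⟩⟩ := hs.residues hc
    exact ⟨⟨hn.le_meromorphicOrderAt, hm.le_meromorphicOrderAt⟩, ⟨n, hn.laurentCoeff_eq⟩,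
      ⟨m, hm.laurentCoeff_eq⟩⟩
  · intro α₀ α₁ α₂ α₃ q₁ p₁ q₂ p₂ h
    exact ⟨constant_terms_sub_mem_int_of_residues q₁ fun c hc =>
        ((h.isMeromorphicSolutionAt c).residues hc).1,
      constant_terms_sub_mem_int_of_residues q₂ fun c hc =>
        ((h.isMeromorphicSolutionAt c).residues hc).2⟩
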